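/- Let $K$ be a field and let $E=(E^0,E^1,s,r)$ be a finite directed graph ($E^0$ and $E^1$ are finite; loops and parallel edges are allowed). A cycle in $E$ is a path $p=e_1e_2\cdots e_n$ with $n\ge 1$, $r(e_i)=s(e_{i+1})$ for $1\le i<n$, $s(e_1)=r(e_n)$, and $s(e_i)\ne s(e_j)$ for $i\ne j$. An edge $f$ is an exit for $p$ if $s(f)=s(e_i)$ and $f\ne e_i$ for some $i$. The graph $E$ is called a no-exit graph if no cycle in $E$ has an exit. The Leavitt path algebra $L_K(E)$ is the (a priori non-unital) associative $K$-algebra generated by the elements $v\in E^0$ and $e, e^*$ with $e\in E^1$, subject to the relations $vw=\delta_{v,w}v$; $s(e)e=e=e\,r(e)$; $r(e)e^*=e^*=e^*s(e)$; $e^*f=\delta_{e,f}\,r(e)$; and $v=\sum_{s(e)=v}ee^*$ for each vertex $v$ that is not a sink. As $E$ is finite, it is unital with $1=\sum_{v\in E^0}v$. For a $K$-algebra $A$ that is generated by a finite-dimensional subspace $V$, let $V^n$ be the span of all products $v_1\cdots v_k$ with $1\le k\le n$ and $v_i\in V$. The Gelfand–Kirillov dimension of $A$ is $$\operatorname{GKdim}A=\limsup_{n\to\infty}\frac{\ln\dim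 V^n}{\ln n}\in[0,\infty],$$ with $\ln 0$ read as $0$ if $A=0$; it does not depend on the choice of $V$. Then $L_K(E)$ is generated by a finite-dimensional subspace, so that $\operatorname{GKdim}L_K(E)$ is defined, and $$E\text{ is a no-exit graph}\iff \operatorname{GKdim}L_K(E)\le 1.$$ -/

import Mathlib

open scoped BigOperators

universe u v w

/-- A directed graph `E = (E⁰, E¹, s, r)`; loops and parallel edges are allowed. -/
structure DirectedMultigraph where
  /-- The set `E⁰` of vertices. -/
  Vertex : Type u
  /-- The set `E¹` of edges. -/
  Edge : Type v
  /-- The source map `s`. -/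
  src : Edge → Vertex
  /-- The range map `r`. -/
  tgt : Edge → Vertex

namespace DirectedMultigraph

variable (E : DirectedMultigraph.{u, v})

/-- `p = e₁ e₂ ⋯ eₙ` (with `n ≥ 1`) is a cycle: `r(eᵢ) = s(eᵢ₊₁)` for `i < n`, `s(e₁) = r(eₙ)`, and
the sources `s(e₁), …, s(eₙ)` are pairwise distinct. -/
def IsCycle (p : List E.Edge) : Prop :=
  ∃ hp : p ≠ [], p.IsChain (fun e f => E.tgt e = E.src f) ∧
    E.src (p.head hp) = E.tgt (p.getLast hp) ∧ (p.map E.src).Nodup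

/-- The edge `f` is an exit for `p = e₁ ⋯ eₙ`: for some `i`, `s(f) = s(eᵢ)` but `f ≠ eᵢ`. -/
def IsExit (f : E.Edge) (p : List E.Edge) : Prop :=
  ∃ e ∈ p, E.src f = E.src e ∧ f ≠ e

/-- No cycle of `E` has an exit. -/
def NoExit : Prop :=
  ∀ p : List E.Edge, E.IsCycle p → ∀ f : E.Edge, ¬ E.IsExit f p

/-- The generators of the Leavitt path algebra: vertices, edges and ghost edges. -/
inductive LeavittGenerator : Type (max u v)
  | vertex (x : E.Vertex) : LeavittGenerator
  | edge (e : E.Edge) : LeavittGenerator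
  | ghost (e : E.Edge) : LeavittGenerator

end DirectedMultigraph

section Leavitt

variable (K : Type w) [Field K] (E : DirectedMultigraph.{u, v})

/-- The generators, inside the free unital algebra. -/
def leavittVertex (x : E.Vertex) : FreeAlgebra K E.LeavittGenerator :=
  FreeAlgebra.ι K (DirectedMultigraph.LeavittGenerator.vertex x)

/-- See `leavittVertex`. -/
def leavittEdge (e : E.Edge) : FreeAlgebra K E.LeavittGenerator :=
  FreeAlgebra.ι K (DirectedMultigraph.LeavittGenerator.edge e)

/-- See `leavittVertex`. -/
def leavittGhost (e : E.Edge) : FreeAlgebra K E.LeavittGenerator :=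
  FreeAlgebra.ι K (DirectedMultigraph.LeavittGenerator.ghost e)

open Classical in
/-- The defining relations of the Leavitt path algebra of a finite graph: the vertices are
orthogonal idempotents, `s(e) e = e = e r(e)`, `r(e) e* = e* = e* s(e)`, `e* f = δ_{e,f} r(e)`, and
`x = ∑_{s(e) = x} e e*` for each vertex `x` that is not a sink.  These relations make `∑ x` an
identity element of the (a priori non-unital) algebra that they present. Since the presentation here
is one of unital algebras, the relation that identifies `∑ x` with `1` is listed too; the resulting
algebra is the same. -/
inductive LeavittRelation [Fintype E.Vertex] [Fintype E.Edge] :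
    FreeAlgebra K E.LeavittGenerator → FreeAlgebra K E.LeavittGenerator → Prop
  | vertex_mul_self (x : E.Vertex) :
      LeavittRelation (leavittVertex K E x * leavittVertex K E x) (leavittVertex K E x)
  | vertex_mul_of_ne (x y : E.Vertex) (h : x ≠ y) :
      LeavittRelation (leavittVertex K E x * leavittVertex K E y) 0
  | src_mul_edge (e : E.Edge) :
      LeavittRelation (leavittVertex K E (E.src e) * leavittEdge K E e) (leavittEdge K E e)
  | edge_mul_tgt (e : E.Edge) :
      LeavittRelation (leavittEdge K E e * leavittVertex K E (E.tgt e)) (leavittEdge K E e)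
  | tgt_mul_ghost (e : E.Edge) :
      LeavittRelation (leavittVertex K E (E.tgt e) * leavittGhost K E e) (leavittGhost K E e)
  | ghost_mul_src (e : E.Edge) :
      LeavittRelation (leavittGhost K E e * leavittVertex K E (E.src e)) (leavittGhost K E e)
  | ghost_mul_edge_self (e : E.Edge) :
      LeavittRelation (leavittGhost K E e * leavittEdge K E e) (leavittVertex K E (E.tgt e))
  | ghost_mul_edge_of_ne (e f : E.Edge) (h : e ≠ f) :
      LeavittRelation (leavittGhost K E e * leavittEdge K E f) 0
  | vertex_eq_sum (x : E.Vertex) (h : ∃ e : E.Edge, E.src e = x) :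
      LeavittRelation (leavittVertex K E x)
        (∑ e : E.Edge with E.src e = x, leavittEdge K E e * leavittGhost K E e)
  | sum_vertex : LeavittRelation (∑ x : E.Vertex, leavittVertex K E x) 1

/-- The Leavitt path algebra `L_K(E)` of a finite graph `E` over a field `K`. -/
def LeavittPathAlgebra [Fintype E.Vertex] [Fintype E.Edge] : Type (max u v w) :=
  RingQuot (LeavittRelation K E)

noncomputable instance [Fintype E.Vertex] [Fintype E.Edge] : Ring (LeavittPathAlgebra K E) :=
  inferInstanceAs (Ring (RingQuot (LeavittRelation K E)))

noncomputable instance [Fintype E.Vertex] [Fintype E.Edge] : Algebra K (LeavittPathAlgebra K E) :=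
  inferInstanceAs (Algebra K (RingQuot (LeavittRelation K E)))

end Leavitt

section GelfandKirillov

variable {K : Type u} [Field K] {A : Type v} [Ring A] [Algebra K A]

/-- The span of all products `v₁ v₂ ⋯ vₖ` with `1 ≤ k ≤ n` and all `vᵢ ∈ V`. -/
def productsUpTo (V : Submodule K A) (n : ℕ) : Submodule K A :=
  ⨆ k ∈ Finset.Icc 1 n, V ^ k

/-- `limsup (ln dim Vⁿ / ln n)`, where `Vⁿ` is spanned by the products of at most `n` factors from
`V`; it is `⊤` exactly if the growth of `dim Vⁿ` is not polynomially bounded. -/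
noncomputable def growthExponent (V : Submodule K A) : EReal :=
  Filter.limsup
    (fun n : ℕ => ((Real.log (Module.finrank K (productsUpTo V n)) / Real.log n : ℝ) : EReal))
    Filter.atTop

/-- `V` is finite-dimensional and generates `A` as a (not necessarily unital) algebra. -/
def IsGeneratingSubspace (V : Submodule K A) : Prop :=
  FiniteDimensional K V ∧ NonUnitalAlgebra.adjoin K (V : Set A) = ⊤

variable (K A) in
/-- `d` is the Gelfand-Kirillov dimension of the `K`-algebra `A`: some finite-dimensional subspace
generates `A`, and each such subspace has growth exponent `d`. -/
def HasGKDim (d : EReal) : Prop :=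
  (∃ V : Submodule K A, IsGeneratingSubspace V) ∧
    ∀ V : Submodule K A, IsGeneratingSubspace V → growthExponent V = d

/-- An algebra has at most one Gelfand-Kirillov dimension. -/
theorem HasGKDim.unique {d d' : EReal} (h : HasGKDim K A d) (h' : HasGKDim K A d') : d = d' := by
  obtain ⟨V, hV⟩ := h.1
  rw [← h.2 V hV, h'.2 V hV]

end GelfandKirillov

/-! Passing from one generating subspace to another rescales `n` by a constant factor, which the
growth exponent does not see. So the span of the vertices, edges and ghost edges decides, and its
products lie in spans of monomials `p v q*` with paths `p`, `q` ending at `v`.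

Suppose that no cycle has an exit. An edge on a closed walk is then the only edge leaving its
source, so a path that enters a cycle stays on it, and the number of paths of a given length is
bounded. If `p` and `q` both have more edges than `E` has vertices, both end on a cycle through `v`,
hence with the same edge `e`, and `e e* = s(e)` shortens both
(`monomial_mem_span_reducedMonomials`). Monomials with one short factor remain, and their number is
linear in `n`.

Suppose that a closed walk `c` starts with an edge `e ≠ f`, where `s(f) = s(e)`. Then `c* c = s(e)`
and `f* c = 0 = c* f`, so `f* (c*)^i c^j f = δ_{i,j} r(f)`. Hence the elements `c^i f f* (c*)^j`
behave like matrix units and are independent (`linearIndependent_mul_of_dual`): there are `n²` of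
them in words of length `O(n)`, and the exponent is at least 2. This needs `r(f) ≠ 0`, which a
concrete representation shows (`vertex_ne_zero`). -/

/-! ### Growth rates of sequences -/

section Growth

open Filter Topology

/-- The exponent of polynomial growth of a sequence of natural numbers. -/
noncomputable def growthRate (f : ℕ → ℕ) : EReal :=
  limsup (fun n : ℕ => ((Real.log (f n) / Real.log n : ℝ) : EReal)) atTop

/-- Rescaling adds the constant `log m` to `log n`, which is negligible in the quotient. The gap
between the two reals `a < b` below absorbs it. -/
theorem growthRate_le_of_le_comp_mul {f g : ℕ → ℕ} {m : ℕ} (hm : 0 < m)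
    (h : ∀ n, f n ≤ g (m * n)) : growthRate f ≤ growthRate g := by
  refine le_of_forall_gt_imp_ge_of_dense fun c hc => ?_
  obtain ⟨a, hga, hac⟩ := EReal.lt_iff_exists_real_btwn.1 hc
  obtain ⟨b, hab, hbc⟩ := EReal.lt_iff_exists_real_btwn.1 hac
  have hab' : a < b := EReal.coe_lt_coe_iff.1 hab
  refine le_trans ?_ hbc.le
  have hg := eventually_lt_of_limsup_lt hga
  have hmul : Tendsto (fun n : ℕ => m * n) atTop atTop :=
    tendsto_id.const_mul_atTop' hm
  have hlog : Tendsto (fun n : ℕ => Real.log n) atTop atTop :=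
    Real.tendsto_log_atTop.comp tendsto_natCast_atTop_atTop
  -- This bound on `log n` amounts to `a * (log m + log n) ≤ b * log n`.
  have hbig := hlog.eventually_ge_atTop (a * Real.log m / (b - a))
  refine limsup_le_of_le (h := ?_)
  filter_upwards [hmul.eventually hg, hbig, eventually_gt_atTop 1] with n hn hn' hn1
  have hn1' : (1 : ℝ) < n := by exact_mod_cast hn1
  have hmR : (1 : ℝ) ≤ m := by exact_mod_cast hm
  have hlogn : 0 < Real.log n := Real.log_pos hn1'
  have hlogmn : Real.log ((m * n : ℕ) : ℝ) = Real.log m + Real.log n := by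
    push_cast
    exact Real.log_mul (by positivity) (by positivity)
  have hpos : 0 < Real.log m + Real.log n := by
    have := Real.log_nonneg hmR
    positivity
  have hn2 := EReal.coe_lt_coe_iff.1 hn
  rw [hlogmn, div_lt_iff₀ hpos] at hn2
  have hfg : Real.log (f n) ≤ Real.log (g (m * n)) := by
    rcases Nat.eq_zero_or_pos (f n) with h0 | h0
    · rw [h0, Nat.cast_zero, Real.log_zero]
      exact Real.log_natCast_nonneg _
    · exact Real.log_le_log (by exact_mod_cast h0) (by exact_mod_cast h n)
  rw [div_le_iff₀ (sub_pos.2 hab')] at hn'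
  rw [EReal.coe_le_coe_iff, div_le_iff₀ hlogn]
  nlinarith

theorem growthRate_pow (d : ℕ) : growthRate (fun n => n ^ d) = d := by
  have h : (fun n : ℕ => ((Real.log ((n ^ d : ℕ) : ℝ) / Real.log n : ℝ) : EReal))
      =ᶠ[atTop] fun _ => (d : EReal) := by
    filter_upwards [eventually_gt_atTop 1] with n hn
    have hn' : Real.log n ≠ 0 := (Real.log_pos (by exact_mod_cast hn)).ne'
    rw [Nat.cast_pow, Real.log_pow, mul_div_cancel_right₀ _ hn']
    simp
  rw [growthRate, limsup_congr h, limsup_const]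

end Growth

/-! ### Independence of the generating subspace -/

section Products

variable {K : Type u} [Field K] {A : Type v} [Ring A] [Algebra K A]

theorem pow_le_productsUpTo (V : Submodule K A) {k n : ℕ} (hk : 1 ≤ k) (hn : k ≤ n) :
    V ^ k ≤ productsUpTo V n :=
  le_iSup₂_of_le k (Finset.mem_Icc.2 ⟨hk, hn⟩) le_rfl

theorem productsUpTo_le_iff {V U : Submodule K A} {n : ℕ} :
    productsUpTo V n ≤ U ↔ ∀ k, 1 ≤ k → k ≤ n → V ^ k ≤ U := by
  simp [productsUpTo, iSup_le_iff]

theorem productsUpTo_mono (V : Submodule K A) {m n : ℕ} (h : m ≤ n) :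
    productsUpTo V m ≤ productsUpTo V n :=
  productsUpTo_le_iff.2 fun _ hk hkm => pow_le_productsUpTo V hk (hkm.trans h)

theorem productsUpTo_mul_le (V : Submodule K A) (m n : ℕ) :
    productsUpTo V m * productsUpTo V n ≤ productsUpTo V (m + n) := by
  conv_lhs => rw [productsUpTo, productsUpTo]
  simp only [Submodule.iSup_mul, Submodule.mul_iSup, iSup_le_iff, Finset.mem_Icc]
  intro i hi j hj
  rw [← pow_add]
  exact pow_le_productsUpTo V (by omega) (by omega)

theorem productsUpTo_pow_le (V : Submodule K A) (m : ℕ) {k : ℕ} (hk : 1 ≤ k) :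
    productsUpTo V m ^ k ≤ productsUpTo V (m * k) := by
  induction k, hk using Nat.le_induction with
  | base => simp
  | succ k _ ih =>
    rw [pow_succ, Nat.mul_succ]
    exact (mul_le_mul' ih le_rfl).trans (productsUpTo_mul_le V _ _)

instance finiteDimensional_productsUpTo (V : Submodule K A) [FiniteDimensional K V] (n : ℕ) :
    FiniteDimensional K (productsUpTo V n) := by
  have hV : V.FG := Module.Finite.iff_fg.1 inferInstance
  exact Module.Finite.iff_fg.2 (Submodule.fg_biSup _ _ fun k _ => hV.pow k)

theorem IsGeneratingSubspace.exists_mem_productsUpTo {V : Submodule K A}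
    (hV : IsGeneratingSubspace V) (a : A) : ∃ n, a ∈ productsUpTo V n := by
  have ha : a ∈ NonUnitalAlgebra.adjoin K (V : Set A) := by
    rw [hV.2]
    trivial
  induction ha using NonUnitalAlgebra.adjoin_induction with
  | mem x hx => exact ⟨1, pow_le_productsUpTo V le_rfl le_rfl (by simpa using hx)⟩
  | add x y _ _ hx hy =>
    obtain ⟨m, hm⟩ := hx
    obtain ⟨n, hn⟩ := hy
    exact ⟨max m n, add_mem (productsUpTo_mono V (le_max_left m n) hm)
      (productsUpTo_mono V (le_max_right m n) hn)⟩
  | zero => exact ⟨0, zero_mem _⟩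
  | mul x y _ _ hx hy =>
    obtain ⟨m, hm⟩ := hx
    obtain ⟨n, hn⟩ := hy
    exact ⟨m + n, productsUpTo_mul_le V m n (Submodule.mul_mem_mul hm hn)⟩
  | smul r x _ hx =>
    obtain ⟨n, hn⟩ := hx
    exact ⟨n, Submodule.smul_mem _ r hn⟩

theorem IsGeneratingSubspace.exists_le_productsUpTo {W : Submodule K A}
    (hW : IsGeneratingSubspace W) (V : Submodule K A) [FiniteDimensional K V] :
    ∃ m, 0 < m ∧ V ≤ productsUpTo W m := by
  obtain ⟨s, rfl⟩ : V.FG := Module.Finite.iff_fg.1 inferInstance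
  choose n hn using hW.exists_mem_productsUpTo
  refine ⟨s.sup n + 1, Nat.succ_pos _, Submodule.span_le.2 fun a ha => ?_⟩
  exact productsUpTo_mono W ((Finset.le_sup (f := n) ha).trans (Nat.le_succ _)) (hn a)

/-- A basis of `V` consists of combinations of words in `W` of length at most some `m`, so words of
length `n` in `V` become words of length at most `m * n` in `W`. -/
theorem IsGeneratingSubspace.growthExponent_le {V W : Submodule K A}
    (hV : IsGeneratingSubspace V) (hW : IsGeneratingSubspace W) :
    growthExponent V ≤ growthExponent W := by
  have := hV.1
  have := hW.1
  obtain ⟨m, hm, hVW⟩ := hW.exists_le_productsUpTo V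
  refine growthRate_le_of_le_comp_mul hm fun n => Submodule.finrank_mono ?_
  refine productsUpTo_le_iff.2 fun k hk hkn => ?_
  exact (pow_le_pow_left' hVW k).trans ((productsUpTo_pow_le W m hk).trans
    (productsUpTo_mono W (Nat.mul_le_mul_left m hkn)))

/-- The growth exponent of one generating subspace is the Gelfand-Kirillov dimension. -/
theorem IsGeneratingSubspace.hasGKDim {V : Submodule K A} (hV : IsGeneratingSubspace V) :
    HasGKDim K A (growthExponent V) :=
  ⟨⟨V, hV⟩, fun _ hW => le_antisymm (hW.growthExponent_le hV) (hV.growthExponent_le hW)⟩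

end Products

/-! ### Closed walks, and counting paths in no-exit graphs -/

namespace DirectedMultigraph

variable {E : DirectedMultigraph.{u, v}}

/-- `l` is the list of edges of a walk from `x` to `y`. -/
def IsWalk (E : DirectedMultigraph.{u, v}) : E.Vertex → List E.Edge → E.Vertex → Prop
  | x, [], y => x = y
  | x, e :: l, y => E.src e = x ∧ IsWalk E (E.tgt e) l y

/-- Some closed walk starts with `e`. -/
def IsRecurrent (E : DirectedMultigraph.{u, v}) (e : E.Edge) : Prop :=
  ∃ l, E.IsWalk (E.tgt e) l (E.src e)

theorem isWalk_append {x z : E.Vertex} {a b : List E.Edge} :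
    E.IsWalk x (a ++ b) z ↔ ∃ y, E.IsWalk x a y ∧ E.IsWalk y b z := by
  induction a generalizing x with
  | nil => simp [IsWalk]
  | cons e a ih => simp [IsWalk, ih, and_assoc]

theorem isWalk_cons_iff {x y : E.Vertex} {e : E.Edge} {l : List E.Edge} :
    E.IsWalk x (e :: l) y ↔ E.src e = x ∧
      (e :: l).IsChain (fun e f => E.tgt e = E.src f) ∧
      E.tgt ((e :: l).getLast (List.cons_ne_nil e l)) = y := by
  induction l generalizing x e with
  | nil => simp [IsWalk]
  | cons f l ih =>
    rw [IsWalk, ih, List.isChain_cons_cons, List.getLast_cons_cons]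
    simp only [eq_comm (a := E.src f), and_assoc]

/-- Cut out the detours between repeated vertices. As `y` is not a source of the new walk,
prepending an edge from `y` to `x` gives a cycle. -/
theorem IsWalk.exists_nodup {x y : E.Vertex} {l : List E.Edge} (h : E.IsWalk x l y) :
    ∃ l', E.IsWalk x l' y ∧ (l'.map E.src).Nodup ∧ y ∉ l'.map E.src := by
  induction l generalizing x with
  | nil => exact ⟨[], h, by simp, by simp⟩
  | cons e l ih =>
    obtain ⟨rfl, h⟩ := h
    obtain ⟨l', hw, hnd, hy⟩ := ih h
    by_cases hxy : E.src e = y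
    · exact ⟨[], hxy, by simp, by simp⟩
    by_cases hmem : E.src e ∈ l'.map E.src
    · obtain ⟨g, hg, hge⟩ := List.mem_map.1 hmem
      obtain ⟨a, b, rfl⟩ := List.append_of_mem hg
      obtain ⟨z, -, hz⟩ := isWalk_append.1 hw
      rw [List.map_append] at hnd hy
      refine ⟨g :: b, ⟨hge, hz.2⟩, hnd.of_append_right, fun h => hy ?_⟩
      exact List.mem_append_right _ h
    · refine ⟨e :: l', ⟨rfl, hw⟩, ?_, ?_⟩
      · exact List.nodup_cons.2 ⟨hmem, hnd⟩
      · simp only [List.map_cons, List.mem_cons, not_or]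
        exact ⟨fun h => hxy h.symm, hy⟩

theorem IsCycle.isRecurrent {p : List E.Edge} (hp : E.IsCycle p) {e : E.Edge} (he : e ∈ p) :
    E.IsRecurrent e := by
  obtain ⟨hne, hch, hcl, -⟩ := hp
  obtain ⟨f, l, rfl⟩ := List.exists_cons_of_ne_nil hne
  have hw : E.IsWalk (E.src f) (f :: l) (E.src f) := isWalk_cons_iff.2 ⟨rfl, hch, hcl.symm⟩
  obtain ⟨a, b, hab⟩ := List.append_of_mem he
  rw [hab] at hw
  obtain ⟨y, ha, hb⟩ := isWalk_append.1 hw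
  obtain ⟨rfl, hb⟩ := hb
  exact ⟨b ++ a, isWalk_append.2 ⟨_, hb, ha⟩⟩

/-- A recurrent edge lies on a cycle, of which any other edge with the same source would be an exit.
-/
theorem NoExit.eq_of_src_eq (hE : E.NoExit) {e f : E.Edge} (he : E.IsRecurrent e)
    (h : E.src f = E.src e) : f = e := by
  obtain ⟨l, hl⟩ := he
  obtain ⟨l', hw, hnd, hy⟩ := hl.exists_nodup
  have hc := isWalk_cons_iff.1 (show E.IsWalk (E.src e) (e :: l') (E.src e) from ⟨rfl, hw⟩)
  by_contra hne
  refine hE (e :: l') ⟨List.cons_ne_nil _ _, hc.2.1, hc.2.2.symm, ?_⟩ f ⟨e, by simp, h, hne⟩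
  exact List.nodup_cons.2 ⟨hy, hnd⟩

theorem not_noExit_iff :
    ¬ E.NoExit ↔ ∃ e f : E.Edge, E.IsRecurrent e ∧ E.src f = E.src e ∧ f ≠ e := by
  constructor
  · intro h
    simp only [NoExit, not_forall, not_not] at h
    obtain ⟨p, hp, f, e, he, hfe⟩ := h
    exact ⟨e, f, hp.isRecurrent he, hfe⟩
  · rintro ⟨e, f, he, hs, hne⟩ hE
    exact hne (hE.eq_of_src_eq he hs)

theorem IsRecurrent.exists_src_eq_tgt {e : E.Edge} (he : E.IsRecurrent e) :
    ∃ g, E.IsRecurrent g ∧ E.src g = E.tgt e := by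
  obtain ⟨_ | ⟨g, l⟩, hl⟩ := he
  · exact ⟨e, ⟨[], hl⟩, hl.symm⟩
  · exact ⟨g, ⟨l ++ [e], isWalk_append.2 ⟨_, hl.2, rfl, hl.1.symm⟩⟩, hl.1⟩

theorem IsRecurrent.exists_tgt_eq_src {e : E.Edge} (he : E.IsRecurrent e) :
    ∃ g, E.IsRecurrent g ∧ E.tgt g = E.src e := by
  obtain ⟨l, hl⟩ := he
  rcases List.eq_nil_or_concat l with rfl | ⟨l, g, rfl⟩
  · exact ⟨e, ⟨[], hl⟩, hl⟩
  · rw [List.concat_eq_append] at hl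
    obtain ⟨y, hy, rfl, hg⟩ := isWalk_append.1 hl
    exact ⟨g, ⟨e :: l, hg.symm, hy⟩, hg⟩

theorem NoExit.isRecurrent_of_src_eq_tgt (hE : E.NoExit) {e f : E.Edge} (he : E.IsRecurrent e)
    (h : E.src f = E.tgt e) : E.IsRecurrent f := by
  obtain ⟨g, hg, hge⟩ := he.exists_src_eq_tgt
  rwa [hE.eq_of_src_eq hg (h.trans hge.symm)]

/-- Recurrent edges have recurrent successors and predecessors, so their sources and their targets
form the same finite set. Sources are injective on them by `NoExit.eq_of_src_eq`, hence by counting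
so are targets. -/
theorem NoExit.eq_of_tgt_eq [Finite E.Edge] (hE : E.NoExit) {e f : E.Edge}
    (he : E.IsRecurrent e) (hf : E.IsRecurrent f) (h : E.tgt e = E.tgt f) : e = f := by
  classical
  have := Fintype.ofFinite E.Edge
  let C : Finset E.Edge := Finset.univ.filter E.IsRecurrent
  have hC : ∀ {g}, g ∈ C ↔ E.IsRecurrent g := by simp [C]
  have himage : C.image E.tgt = C.image E.src := by
    ext x
    simp only [Finset.mem_image, hC]
    constructor
    · rintro ⟨g, hg, rfl⟩
      exact hg.exists_src_eq_tgt
    · rintro ⟨g, hg, rfl⟩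
      exact hg.exists_tgt_eq_src
  have hsrc : Set.InjOn E.src C := fun a _ b hb hab => hE.eq_of_src_eq (hC.1 hb) hab
  have htgt : Set.InjOn E.tgt C := by
    rw [← Finset.card_image_iff, himage, Finset.card_image_iff]
    exact hsrc
  exact htgt (hC.2 he) (hC.2 hf) h

/-- The reversal of `p` is the list of edges of a walk that ends at `x`. -/
def IsReversePath (E : DirectedMultigraph.{u, v}) : List E.Edge → E.Vertex → Prop
  | [], _ => True
  | e :: p, x => E.tgt e = x ∧ IsReversePath E p (E.src e)

theorem IsReversePath.exists_isWalk {p : List E.Edge} {x : E.Vertex} (hp : E.IsReversePath p x)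
    {e : E.Edge} (he : e ∈ p) : ∃ l, E.IsWalk (E.tgt e) l x := by
  induction p generalizing x with
  | nil => simp at he
  | cons f p ih =>
    rcases List.mem_cons.1 he with rfl | he
    · exact ⟨[], hp.1⟩
    · obtain ⟨l, hl⟩ := ih hp.2 he
      exact ⟨l ++ [f], isWalk_append.2 ⟨_, hl, rfl, hp.1⟩⟩

/-- A path that returns to the source of one of its edges contains a closed walk starting with that
edge. -/
theorem IsReversePath.nodup_map_src {p : List E.Edge} {x : E.Vertex} (hp : E.IsReversePath p x)
    (h : ∀ e ∈ p, ¬ E.IsRecurrent e) : (p.map E.src).Nodup := by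
  induction p generalizing x with
  | nil => simp
  | cons e p ih =>
    refine List.nodup_cons.2 ⟨fun hmem => ?_, ih hp.2 fun f hf => h f (List.mem_cons_of_mem _ hf)⟩
    obtain ⟨g, hg, hge⟩ := List.mem_map.1 hmem
    obtain ⟨l, hl⟩ := hp.2.exists_isWalk hg
    exact h g (List.mem_cons_of_mem _ hg) ⟨l, by rwa [hge]⟩

/-- Edges that follow a recurrent edge are recurrent, so a path whose last edge (the head of the
list) is not recurrent never met a cycle. -/
theorem NoExit.forall_not_isRecurrent (hE : E.NoExit) {e : E.Edge} {p : List E.Edge}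
    {x : E.Vertex} (hp : E.IsReversePath (e :: p) x) (he : ¬ E.IsRecurrent e) :
    ∀ f ∈ e :: p, ¬ E.IsRecurrent f := by
  induction p generalizing e x with
  | nil => simpa using he
  | cons g p ih =>
    intro f hf
    rcases List.mem_cons.1 hf with rfl | hf
    · exact he
    · exact ih hp.2 (fun hg => he (hE.isRecurrent_of_src_eq_tgt hg hp.2.1.symm)) f hf

theorem NoExit.isRecurrent_of_card_lt [Fintype E.Vertex] (hE : E.NoExit) {e : E.Edge}
    {p : List E.Edge} {x : E.Vertex} (hp : E.IsReversePath (e :: p) x)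
    (h : Fintype.card E.Vertex < (e :: p).length) : E.IsRecurrent e := by
  by_contra he
  have := (hp.nodup_map_src (hE.forall_not_isRecurrent hp he)).length_le_card
  rw [List.length_map] at this
  omega

/-- The reversals of the paths with `m` edges. -/
def reversePaths (E : DirectedMultigraph.{u, v}) (m : ℕ) : Set (List E.Edge) :=
  {p | p.length = m ∧ ∃ x, E.IsReversePath p x}

theorem finite_reversePaths [Finite E.Edge] (m : ℕ) : (E.reversePaths m).Finite :=
  (List.finite_length_eq E.Edge m).subset fun _ hp => hp.1

/-- Deleting the last edge loses nothing: on so long a path that edge is recurrent, hence the only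
one leaving its source. -/
theorem NoExit.ncard_reversePaths_succ_le [Fintype E.Vertex] [Finite E.Edge] (hE : E.NoExit)
    {m : ℕ} (hm : Fintype.card E.Vertex < m) :
    (E.reversePaths (m + 1)).ncard ≤ (E.reversePaths m).ncard := by
  refine Set.ncard_le_ncard_of_injOn List.tail ?_ ?_ (finite_reversePaths m)
  · rintro (_ | ⟨e, p⟩) ⟨hl, x, hp⟩
    · simp at hl
    · exact ⟨by simpa using hl, _, hp.2⟩
  · rintro (_ | ⟨e, p⟩) ⟨hl, x, hp⟩ (_ | ⟨f, q⟩) ⟨hl', y, hq⟩ hpq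
    · rfl
    · simp at hl
    · simp at hl'
    · obtain rfl : p = q := hpq
      obtain _ | ⟨g, p⟩ := p
      · simp at hl
        omega
      · have hf := hE.isRecurrent_of_card_lt hq (by omega)
        rw [hE.eq_of_src_eq hf (hp.2.1.symm.trans hq.2.1)]

theorem NoExit.exists_ncard_reversePaths_le [Fintype E.Vertex] [Finite E.Edge] (hE : E.NoExit) :
    ∃ C, ∀ m, (E.reversePaths m).ncard ≤ C := by
  set N := Fintype.card E.Vertex
  -- The sum covers the lengths up to `N + 1`; from there on the counts do not increase.
  refine ⟨∑ m ∈ Finset.range (N + 2), (E.reversePaths m).ncard, fun m => ?_⟩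
  have hsmall : ∀ m < N + 2, (E.reversePaths m).ncard ≤
      ∑ m ∈ Finset.range (N + 2), (E.reversePaths m).ncard := fun m hm =>
    Finset.single_le_sum (f := fun m => (E.reversePaths m).ncard) (fun _ _ => Nat.zero_le _)
      (Finset.mem_range.2 hm)
  induction m with
  | zero => exact hsmall 0 (by omega)
  | succ m ih =>
    by_cases hm : m + 1 < N + 2
    · exact hsmall _ hm
    · exact (hE.ncard_reversePaths_succ_le (by omega)).trans ih

/-- The reversals of the paths with at most `n` edges. -/
def reversePathsUpTo (E : DirectedMultigraph.{u, v}) (n : ℕ) : Set (List E.Edge) :=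
  {p | p.length ≤ n ∧ ∃ x, E.IsReversePath p x}

theorem finite_reversePathsUpTo [Finite E.Edge] (n : ℕ) : (E.reversePathsUpTo n).Finite :=
  (List.finite_length_le E.Edge n).subset fun _ hp => hp.1

theorem ncard_reversePathsUpTo_le [Finite E.Edge] {C : ℕ}
    (hC : ∀ m, (E.reversePaths m).ncard ≤ C) (n : ℕ) :
    (E.reversePathsUpTo n).ncard ≤ (n + 1) * C := by
  have h : E.reversePathsUpTo n = ⋃ m ∈ Finset.range (n + 1), E.reversePaths m := by
    ext p
    simp [reversePathsUpTo, reversePaths]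
  rw [h]
  refine (Finset.set_ncard_biUnion_le _ _).trans ?_
  refine (Finset.sum_le_card_nsmul _ _ C fun m _ => hC m).trans ?_
  simp

end DirectedMultigraph

/-! ### The Leavitt path algebra and its generators -/

namespace LeavittPathAlgebra

variable (K : Type w) [Field K] (E : DirectedMultigraph.{u, v})
  [Fintype E.Vertex] [Fintype E.Edge]

/-- The presentation of `L_K(E)` as a quotient of a free algebra. -/
noncomputable def mk : FreeAlgebra K E.LeavittGenerator →ₐ[K] LeavittPathAlgebra K E :=
  RingQuot.mkAlgHom K (LeavittRelation K E)

theorem mk_surjective : Function.Surjective (mk K E) :=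
  RingQuot.mkAlgHom_surjective K (LeavittRelation K E)

/-- The generators of `L_K(E)`. -/
noncomputable def gen (g : E.LeavittGenerator) : LeavittPathAlgebra K E :=
  mk K E (FreeAlgebra.ι K g)

variable {E}

/-- The idempotent of a vertex. -/
noncomputable abbrev vertex (x : E.Vertex) : LeavittPathAlgebra K E := gen K E (.vertex x)

/-- The element of an edge. -/
noncomputable abbrev edge (e : E.Edge) : LeavittPathAlgebra K E := gen K E (.edge e)

/-- The element of a ghost edge. -/
noncomputable abbrev ghost (e : E.Edge) : LeavittPathAlgebra K E := gen K E (.ghost e)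

variable {K}

theorem mk_eq_mk {a b : FreeAlgebra K E.LeavittGenerator} (h : LeavittRelation K E a b) :
    mk K E a = mk K E b :=
  RingQuot.mkAlgHom_rel K h

theorem vertex_mul_self (x : E.Vertex) : vertex K x * vertex K x = vertex K x := by
  have h := mk_eq_mk (LeavittRelation.vertex_mul_self (K := K) x)
  simp only [map_mul] at h
  exact h

theorem vertex_mul_of_ne {x y : E.Vertex} (h : x ≠ y) : vertex K x * vertex K y = 0 := by
  have h := mk_eq_mk (LeavittRelation.vertex_mul_of_ne (K := K) x y h)
  simp only [map_mul, map_zero] at h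
  exact h

theorem src_mul_edge (e : E.Edge) : vertex K (E.src e) * edge K e = edge K e := by
  have h := mk_eq_mk (LeavittRelation.src_mul_edge (K := K) e)
  simp only [map_mul] at h
  exact h

theorem edge_mul_tgt (e : E.Edge) : edge K e * vertex K (E.tgt e) = edge K e := by
  have h := mk_eq_mk (LeavittRelation.edge_mul_tgt (K := K) e)
  simp only [map_mul] at h
  exact h

theorem tgt_mul_ghost (e : E.Edge) : vertex K (E.tgt e) * ghost K e = ghost K e := by
  have h := mk_eq_mk (LeavittRelation.tgt_mul_ghost (K := K) e)
  simp only [map_mul] at h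
  exact h

theorem ghost_mul_src (e : E.Edge) : ghost K e * vertex K (E.src e) = ghost K e := by
  have h := mk_eq_mk (LeavittRelation.ghost_mul_src (K := K) e)
  simp only [map_mul] at h
  exact h

theorem ghost_mul_edge_self (e : E.Edge) : ghost K e * edge K e = vertex K (E.tgt e) := by
  have h := mk_eq_mk (LeavittRelation.ghost_mul_edge_self (K := K) e)
  simp only [map_mul] at h
  exact h

theorem ghost_mul_edge_of_ne {e f : E.Edge} (h : e ≠ f) : ghost K e * edge K f = 0 := by
  have h := mk_eq_mk (LeavittRelation.ghost_mul_edge_of_ne (K := K) e f h)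
  simp only [map_mul, map_zero] at h
  exact h

open Classical in
theorem vertex_eq_sum {x : E.Vertex} (h : ∃ e : E.Edge, E.src e = x) :
    vertex K x = ∑ e : E.Edge with E.src e = x, edge K e * ghost K e := by
  have h := mk_eq_mk (LeavittRelation.vertex_eq_sum (K := K) x h)
  simp only [map_mul, map_sum] at h
  exact h

theorem sum_vertex : ∑ x : E.Vertex, vertex K x = 1 := by
  have h := mk_eq_mk (LeavittRelation.sum_vertex (K := K) (E := E))
  simp only [map_sum, map_one] at h
  exact h

theorem vertex_mul_edge_of_ne {x : E.Vertex} {e : E.Edge} (h : x ≠ E.src e) :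
    vertex K x * edge K e = 0 := by
  rw [← src_mul_edge, ← mul_assoc, vertex_mul_of_ne h, zero_mul]

theorem edge_mul_vertex_of_ne {x : E.Vertex} {e : E.Edge} (h : E.tgt e ≠ x) :
    edge K e * vertex K x = 0 := by
  rw [← edge_mul_tgt, mul_assoc, vertex_mul_of_ne h, mul_zero]

theorem vertex_mul_ghost_of_ne {x : E.Vertex} {e : E.Edge} (h : x ≠ E.tgt e) :
    vertex K x * ghost K e = 0 := by
  rw [← tgt_mul_ghost, ← mul_assoc, vertex_mul_of_ne h, zero_mul]

theorem ghost_mul_vertex_of_ne {x : E.Vertex} {e : E.Edge} (h : E.src e ≠ x) :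
    ghost K e * vertex K x = 0 := by
  rw [← ghost_mul_src, mul_assoc, vertex_mul_of_ne h, mul_zero]

theorem edge_mul_ghost_of_forall_eq {e : E.Edge} (h : ∀ f, E.src f = E.src e → f = e) :
    edge K e * ghost K e = vertex K (E.src e) := by
  classical
  rw [vertex_eq_sum ⟨e, rfl⟩, Finset.sum_eq_single e]
  · intro f hf hfe
    exact absurd (h f (Finset.mem_filter.1 hf).2) hfe
  · simp

variable (K E)

/-- The span of the generators. -/
noncomputable def generatorSpan : Submodule K (LeavittPathAlgebra K E) :=
  Submodule.span K (Set.range (gen K E))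

variable {K E}

theorem gen_mem_generatorSpan (g : E.LeavittGenerator) : gen K E g ∈ generatorSpan K E :=
  Submodule.subset_span ⟨g, rfl⟩

theorem finite_generator : Finite E.LeavittGenerator := by
  refine Finite.of_surjective
    (fun s : E.Vertex ⊕ E.Edge ⊕ E.Edge => (Sum.elim .vertex (Sum.elim .edge .ghost) s :
      E.LeavittGenerator)) ?_
  rintro (x | e | e)
  exacts [⟨.inl x, rfl⟩, ⟨.inr (.inl e), rfl⟩, ⟨.inr (.inr e), rfl⟩]

theorem isGeneratingSubspace_generatorSpan : IsGeneratingSubspace (generatorSpan K E) := by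
  have := finite_generator (E := E)
  refine ⟨FiniteDimensional.span_of_finite K (Set.finite_range _), ?_⟩
  rw [eq_top_iff]
  rintro a -
  obtain ⟨a, rfl⟩ := mk_surjective K E a
  have hgen (g : E.LeavittGenerator) : gen K E g ∈
      NonUnitalAlgebra.adjoin K (generatorSpan K E : Set (LeavittPathAlgebra K E)) :=
    NonUnitalAlgebra.subset_adjoin K (gen_mem_generatorSpan g)
  induction a using FreeAlgebra.induction with
  | grade0 r =>
    -- The adjoined algebra is non-unital, so scalars enter it through `1 = ∑ x`.
    rw [AlgHom.commutes, Algebra.algebraMap_eq_smul_one, ← sum_vertex]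
    exact SMulMemClass.smul_mem r (sum_mem fun x _ => hgen _)
  | grade1 g => exact hgen g
  | mul a b ha hb =>
    rw [map_mul]
    exact mul_mem ha hb
  | add a b ha hb =>
    rw [map_add]
    exact add_mem ha hb

/-! ### Linear growth without exits -/

variable (K)

/-- The product `p v q*`, where `p` and `q` are reversed lists of edges. -/
noncomputable def monomial (p : List E.Edge) (x : E.Vertex) (q : List E.Edge) :
    LeavittPathAlgebra K E :=
  (p.reverse.map (edge K)).prod * vertex K x * (q.map (ghost K)).prod

variable {K}

theorem edges_mul_vertex_eq_zero {p : List E.Edge} {x : E.Vertex} (h : ¬ E.IsReversePath p x) :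
    (p.reverse.map (edge K)).prod * vertex K x = 0 := by
  induction p generalizing x with
  | nil => exact absurd trivial h
  | cons e p ih =>
    rw [List.reverse_cons, List.map_append, List.prod_append, List.map_singleton,
      List.prod_singleton, mul_assoc]
    by_cases hx : E.tgt e = x
    · subst hx
      rw [edge_mul_tgt, ← src_mul_edge, ← mul_assoc, ih fun hp => h ⟨rfl, hp⟩, zero_mul]
    · rw [edge_mul_vertex_of_ne hx, mul_zero]

theorem vertex_mul_ghosts_eq_zero {q : List E.Edge} {x : E.Vertex} (h : ¬ E.IsReversePath q x) :
    vertex K x * (q.map (ghost K)).prod = 0 := by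
  induction q generalizing x with
  | nil => exact absurd trivial h
  | cons e q ih =>
    rw [List.map_cons, List.prod_cons, ← mul_assoc]
    by_cases hx : E.tgt e = x
    · subst hx
      rw [tgt_mul_ghost, ← ghost_mul_src, mul_assoc, ih fun hq => h ⟨rfl, hq⟩, mul_zero]
    · rw [vertex_mul_ghost_of_ne (Ne.symm hx), zero_mul]

theorem monomial_eq_zero {p q : List E.Edge} {x : E.Vertex}
    (h : ¬ (E.IsReversePath p x ∧ E.IsReversePath q x)) : monomial K p x q = 0 := by
  rw [not_and_or] at h
  rcases h with h | h
  · rw [monomial, edges_mul_vertex_eq_zero h, zero_mul]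
  · rw [monomial, mul_assoc, vertex_mul_ghosts_eq_zero h, mul_zero]

/-- The sum relation at `s(e)` has the single term `e e*`, so the innermost pair collapses to a
vertex. -/
theorem monomial_cons_cons {e : E.Edge} (h : ∀ f, E.src f = E.src e → f = e)
    (p q : List E.Edge) :
    monomial K (e :: p) (E.tgt e) (e :: q) = monomial K p (E.src e) q := by
  simp only [monomial, List.reverse_cons, List.map_append, List.prod_append, List.map_cons,
    List.map_nil, List.prod_cons, List.prod_nil, mul_one]
  rw [← edge_mul_ghost_of_forall_eq h, mul_assoc _ (edge K e), edge_mul_tgt]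
  simp only [mul_assoc]

/-- This and `monomial_append_mul_gen` keep the monomials, up to zero, stable under right
multiplication by generators. Without ghost edges the new factor meets the middle vertex; otherwise
it meets the last ghost edge. -/
theorem monomial_nil_mul_gen (p : List E.Edge) (x : E.Vertex) (g : E.LeavittGenerator) :
    monomial K p x [] * gen K E g = 0 ∨
      ∃ p' y q', monomial K p x [] * gen K E g = monomial K p' y q' ∧
        p'.length ≤ p.length + 1 ∧ q'.length ≤ 1 := by
  simp only [monomial, List.map_nil, List.prod_nil, mul_one, mul_assoc]
  rcases g with y | e | e
  · by_cases h : x = y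
    · subst h
      refine .inr ⟨p, x, [], ?_, by simp, by simp⟩
      rw [vertex_mul_self]
      simp
    · left
      rw [vertex_mul_of_ne h, mul_zero]
  · by_cases h : x = E.src e
    · subst h
      refine .inr ⟨e :: p, E.tgt e, [], ?_, by simp, by simp⟩
      rw [src_mul_edge]
      simp [mul_assoc, edge_mul_tgt]
    · left
      rw [vertex_mul_edge_of_ne h, mul_zero]
  · exact .inr ⟨p, x, [e], by simp, by simp, by simp⟩

theorem monomial_append_mul_gen (p : List E.Edge) (x : E.Vertex) (q : List E.Edge) (f : E.Edge)
    (g : E.LeavittGenerator) :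
    monomial K p x (q ++ [f]) * gen K E g = 0 ∨
      ∃ q', monomial K p x (q ++ [f]) * gen K E g = monomial K p x q' ∧
        q'.length ≤ q.length + 2 := by
  rcases g with y | e | e
  · by_cases h : E.src f = y
    · subst h
      refine .inr ⟨q ++ [f], ?_, by simp⟩
      simp [monomial, mul_assoc, ghost_mul_src]
    · left
      simp [monomial, mul_assoc, ghost_mul_vertex_of_ne h]
  · by_cases h : f = e
    · subst h
      rcases List.eq_nil_or_concat q with rfl | ⟨q, e, rfl⟩
      · by_cases hx : x = E.tgt f
        · subst hx
          refine .inr ⟨[], ?_, by simp⟩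
          simp [monomial, mul_assoc, ghost_mul_edge_self, vertex_mul_self]
        · left
          simp [monomial, mul_assoc, ghost_mul_edge_self, vertex_mul_of_ne hx]
      · by_cases hx : E.src e = E.tgt f
        · refine .inr ⟨q ++ [e], ?_, by simp⟩
          simp [monomial, mul_assoc, ghost_mul_edge_self, ← hx, ghost_mul_src]
        · left
          simp [monomial, mul_assoc, ghost_mul_edge_self, ghost_mul_vertex_of_ne hx]
    · left
      simp [monomial, mul_assoc, ghost_mul_edge_of_ne h]
  · exact .inr ⟨q ++ [f, e], by simp [monomial, mul_assoc], by simp⟩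

variable (K E)

/-- The span of the monomials `p v q*` with factors of length at most `n`. -/
noncomputable def monomialSpan (n : ℕ) : Submodule K (LeavittPathAlgebra K E) :=
  Submodule.span K {a | ∃ p x q, a = monomial K p x q ∧ p.length ≤ n ∧ q.length ≤ n}

variable {K E}

theorem monomialSpan_mono {m n : ℕ} (h : m ≤ n) : monomialSpan K E m ≤ monomialSpan K E n :=
  Submodule.span_mono fun _ ⟨p, x, q, ha, hp, hq⟩ => ⟨p, x, q, ha, hp.trans h, hq.trans h⟩

theorem monomial_mem_monomialSpan {p q : List E.Edge} (x : E.Vertex) {n : ℕ} (hp : p.length ≤ n)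
    (hq : q.length ≤ n) : monomial K p x q ∈ monomialSpan K E n :=
  Submodule.subset_span ⟨p, x, q, rfl, hp, hq⟩

theorem monomialSpan_mul_generatorSpan_le (n : ℕ) :
    monomialSpan K E n * generatorSpan K E ≤ monomialSpan K E (n + 1) := by
  rw [monomialSpan, generatorSpan, Submodule.span_mul_span, Submodule.span_le]
  rintro _ ⟨_, ⟨p, x, q, rfl, hp, hq⟩, _, ⟨g, rfl⟩, rfl⟩
  rw [SetLike.mem_coe]
  beta_reduce
  rcases List.eq_nil_or_concat q with rfl | ⟨q, f, rfl⟩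
  · obtain h | ⟨p', y, q', h, hp', hq'⟩ := monomial_nil_mul_gen (K := K) p x g
    · rw [h]
      exact zero_mem _
    · rw [h]
      exact monomial_mem_monomialSpan y (by omega) (by omega)
  · rw [List.concat_eq_append] at hq ⊢
    obtain h | ⟨q', h, hq'⟩ := monomial_append_mul_gen (K := K) p x q f g
    · rw [h]
      exact zero_mem _
    · rw [h]
      rw [List.length_append, List.length_singleton] at hq
      exact monomial_mem_monomialSpan x (by omega) (by omega)

theorem generatorSpan_pow_le (n : ℕ) : generatorSpan K E ^ n ≤ monomialSpan K E n := by
  induction n with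
  | zero =>
    rw [pow_zero, Submodule.one_le, ← sum_vertex]
    refine sum_mem fun x _ => ?_
    have h := monomial_mem_monomialSpan (K := K) (p := []) (q := []) x le_rfl le_rfl
    simpa [monomial] using h
  | succ n ih =>
    rw [pow_succ]
    exact (mul_le_mul' ih le_rfl).trans (monomialSpan_mul_generatorSpan_le n)

theorem productsUpTo_generatorSpan_le (n : ℕ) :
    productsUpTo (generatorSpan K E) n ≤ monomialSpan K E n :=
  productsUpTo_le_iff.2 fun k _ hk => (generatorSpan_pow_le k).trans (monomialSpan_mono hk)

variable (K E) in
/-- The monomials `p v q*` with factors of length at most `n`, one of which has at most as many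
edges as `E` has vertices. -/
def reducedMonomials (n : ℕ) : Set (LeavittPathAlgebra K E) :=
  let N := Fintype.card E.Vertex
  (fun t : List E.Edge × E.Vertex × List E.Edge => monomial K t.1 t.2.1 t.2.2) ''
    (E.reversePathsUpTo n ×ˢ Set.univ ×ˢ E.reversePathsUpTo N ∪
      E.reversePathsUpTo N ×ˢ Set.univ ×ˢ E.reversePathsUpTo n)

/-- If both factors are long, their last edges are recurrent with the common target `x`, hence
equal, and cancel. Repeat until one factor is short. -/
theorem monomial_mem_span_reducedMonomials (hE : E.NoExit) {p q : List E.Edge} {n : ℕ}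
    (x : E.Vertex) (hp : p.length ≤ n) (hq : q.length ≤ n) :
    monomial K p x q ∈ Submodule.span K (reducedMonomials K E n) := by
  induction p generalizing x q with
  | nil =>
    by_cases h : E.IsReversePath ([] : List E.Edge) x ∧ E.IsReversePath q x
    · exact Submodule.subset_span
        ⟨([], x, q), .inr ⟨⟨Nat.zero_le _, x, h.1⟩, trivial, hq, x, h.2⟩, rfl⟩
    · rw [monomial_eq_zero h]
      exact zero_mem _
  | cons e p ih =>
    by_cases h : E.IsReversePath (e :: p) x ∧ E.IsReversePath q x
    swap
    · rw [monomial_eq_zero h]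
      exact zero_mem _
    by_cases hpN : (e :: p).length ≤ Fintype.card E.Vertex
    · exact Submodule.subset_span
        ⟨(e :: p, x, q), .inr ⟨⟨hpN, x, h.1⟩, trivial, hq, x, h.2⟩, rfl⟩
    by_cases hqN : q.length ≤ Fintype.card E.Vertex
    · exact Submodule.subset_span
        ⟨(e :: p, x, q), .inl ⟨⟨hp, x, h.1⟩, trivial, hqN, x, h.2⟩, rfl⟩
    obtain _ | ⟨f, q⟩ := q
    · simp at hqN
    have he := hE.isRecurrent_of_card_lt h.1 (not_le.1 hpN)
    have hf := hE.isRecurrent_of_card_lt h.2 (not_le.1 hqN)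
    obtain rfl := hE.eq_of_tgt_eq he hf (h.1.1.trans h.2.1.symm)
    obtain rfl := h.1.1
    rw [monomial_cons_cons fun f hf => hE.eq_of_src_eq he hf]
    exact ih _ (by simp at hp; omega) (by simp at hq; omega)

theorem exists_ncard_reducedMonomials_le (hE : E.NoExit) :
    ∃ D, ∀ n, (reducedMonomials K E n).Finite ∧ (reducedMonomials K E n).ncard ≤ D * (n + 1) := by
  obtain ⟨C, hC⟩ := hE.exists_ncard_reversePaths_le
  set N := Fintype.card E.Vertex with hN
  -- Two families, each with at most `(n + 1) * C` long paths, `N` vertices and `(N + 1) * C` short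
  -- paths.
  refine ⟨2 * (C * (N * ((N + 1) * C))), fun n => ?_⟩
  have hfin (m : ℕ) := DirectedMultigraph.finite_reversePathsUpTo (E := E) m
  have hfin1 := (hfin n).prod ((Set.finite_univ (α := E.Vertex)).prod (hfin N))
  have hfin2 := (hfin N).prod ((Set.finite_univ (α := E.Vertex)).prod (hfin n))
  have hcard := DirectedMultigraph.ncard_reversePathsUpTo_le (E := E) hC
  refine ⟨(hfin1.union hfin2).image _, ?_⟩
  refine (Set.ncard_image_le (hfin1.union hfin2)).trans ((Set.ncard_union_le _ _).trans ?_)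
  simp only [Set.ncard_prod, Set.ncard_univ, Nat.card_eq_fintype_card, ← hN]
  calc _ ≤ (n + 1) * C * (N * ((N + 1) * C)) + (N + 1) * C * (N * ((n + 1) * C)) := by
        gcongr <;> exact hcard _
    _ = _ := by ring

theorem growthExponent_generatorSpan_le_one (hE : E.NoExit) :
    growthExponent (generatorSpan K E) ≤ 1 := by
  obtain ⟨D, hD⟩ := exists_ncard_reducedMonomials_le (K := K) hE
  have h : growthExponent (generatorSpan K E) ≤ growthRate fun n => n ^ 1 := by
    -- For `n ≥ 1`, `D * (n + 1) ≤ 2 * D * n`; the extra `1` keeps the factor positive if `D = 0`.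
    -- The case `n = 0` is separate.
    refine growthRate_le_of_le_comp_mul (m := 2 * D + 1) (by omega) fun n => ?_
    obtain rfl | hn := Nat.eq_zero_or_pos n
    · have h0 : productsUpTo (generatorSpan K E) 0 = ⊥ := by simp [productsUpTo]
      rw [h0, finrank_bot]
      exact Nat.zero_le _
    have hfin := (hD n).1
    have := FiniteDimensional.span_of_finite K hfin
    have hle : productsUpTo (generatorSpan K E) n ≤
        Submodule.span K (reducedMonomials K E n) := by
      refine (productsUpTo_generatorSpan_le n).trans (Submodule.span_le.2 ?_)
      rintro _ ⟨p, x, q, rfl, hp, hq⟩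
      exact monomial_mem_span_reducedMonomials hE x hp hq
    have hspan : Module.finrank K (Submodule.span K (reducedMonomials K E n)) ≤
        (reducedMonomials K E n).ncard := by
      have := hfin.fintype
      rw [Set.ncard_eq_toFinset_card']
      exact finrank_span_le_card _
    calc _ ≤ D * (n + 1) := (Submodule.finrank_mono hle).trans (hspan.trans (hD n).2)
      _ ≤ ((2 * D + 1) * n) ^ 1 := by nlinarith
  rw [growthRate_pow] at h
  exact_mod_cast h

/-! ### Nonvanishing of the vertices -/

/-- A family of injections of `ℕ` indexed by the edges, such that those of the edges with a given
source partition `ℕ`. -/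
theorem exists_edge_coding :
    ∃ φ : E.Edge → ℕ → ℕ,
      (∀ e f m n, E.src e = E.src f → (φ e m = φ f n ↔ e = f ∧ m = n)) ∧
      ∀ x k, (∃ e, E.src e = x) → ∃ e m, E.src e = x ∧ φ e m = k := by
  -- Both sides are countably infinite, however many edges leave `x`.
  have h (x : E.Vertex) (hx : ∃ e, E.src e = x) :
      Nonempty ({e // E.src e = x} × ℕ ≃ ℕ) := by
    have : Nonempty {e // E.src e = x} := let ⟨e, he⟩ := hx; ⟨⟨e, he⟩⟩
    exact nonempty_equiv_of_countable
  let ψ (x : E.Vertex) (hx : ∃ e, E.src e = x) := Classical.choice (h x hx)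
  refine ⟨fun e m => ψ (E.src e) ⟨e, rfl⟩ (⟨e, rfl⟩, m), ?_, ?_⟩
  · intro e f m n hef
    have hφ (x : E.Vertex) (hx : E.src f = x) :
        ψ (E.src f) ⟨f, rfl⟩ (⟨f, rfl⟩, n) = ψ x ⟨f, hx⟩ (⟨f, hx⟩, n) := by
      subst hx
      rfl
    beta_reduce
    rw [hφ _ hef.symm]
    simp
  · intro x k hx
    obtain ⟨⟨⟨e, he⟩, m⟩, hk⟩ := (ψ x hx).surjective k
    subst he
    exact ⟨e, m, rfl, hk⟩

open Classical in
/-- The action of the generators on functions on `E⁰ × ℕ`. -/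
noncomputable def codedAction (K : Type w) [Field K] (φ : E.Edge → ℕ → ℕ) :
    E.LeavittGenerator → Module.End K (E.Vertex × ℕ → K)
  | .vertex x => LinearMap.pi fun t => if t.1 = x then LinearMap.proj t else 0
  | .edge e => LinearMap.pi fun t =>
      if h : t.1 = E.src e ∧ ∃ m, φ e m = t.2 then LinearMap.proj (E.tgt e, h.2.choose) else 0
  | .ghost e => LinearMap.pi fun t =>
      if t.1 = E.tgt e then LinearMap.proj (E.src e, φ e t.2) else 0

/-- The coded action satisfies the relations: the ranges of `φ e`, for the edges leaving a vertex,
are disjoint and cover `ℕ`, which gives `e* f = 0` for `e ≠ f` and the sum relation. A vertex acts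
as restriction to its own copy of `ℕ`, which is not zero. -/
theorem vertex_ne_zero (x : E.Vertex) : vertex K x ≠ 0 := by
  classical
  obtain ⟨φ, hφ, hφ'⟩ := exists_edge_coding (E := E)
  have hv (x : E.Vertex) (g : E.Vertex × ℕ → K) (t : E.Vertex × ℕ) :
      codedAction K φ (.vertex x) g t = if t.1 = x then g t else 0 := by
    simp only [codedAction, LinearMap.pi_apply]
    split_ifs <;> rfl
  have hg (e : E.Edge) (g : E.Vertex × ℕ → K) (t : E.Vertex × ℕ) :
      codedAction K φ (.ghost e) g t = if t.1 = E.tgt e then g (E.src e, φ e t.2) else 0 := by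
    simp only [codedAction, LinearMap.pi_apply]
    split_ifs <;> rfl
  have he (e : E.Edge) (g : E.Vertex × ℕ → K) (m : ℕ) :
      codedAction K φ (.edge e) g (E.src e, φ e m) = g (E.tgt e, m) := by
    have h : ∃ n, φ e n = φ e m := ⟨m, rfl⟩
    have hm : h.choose = m := ((hφ e e _ _ rfl).1 h.choose_spec).2
    simp only [codedAction, LinearMap.pi_apply]
    rw [dif_pos ⟨trivial, h⟩, LinearMap.proj_apply]
    exact congrArg (fun n => g (E.tgt e, n)) hm
  have he0 (e : E.Edge) (g : E.Vertex × ℕ → K) (t : E.Vertex × ℕ)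
      (h : ¬ (t.1 = E.src e ∧ ∃ m, φ e m = t.2)) : codedAction K φ (.edge e) g t = 0 := by
    simp only [codedAction, LinearMap.pi_apply]
    rw [dif_neg h, LinearMap.zero_apply]
  have hrel : ∀ ⦃a b⦄, LeavittRelation K E a b →
      FreeAlgebra.lift K (codedAction K φ) a = FreeAlgebra.lift K (codedAction K φ) b := by
    intro a b hab
    refine LinearMap.ext fun g => funext fun t => ?_
    have hmul (S T : Module.End K (E.Vertex × ℕ → K)) (g) : (S * T) g = S (T g) := rfl
    induction hab with
    | vertex_mul_self x => by_cases h : t.1 = x <;> simp [leavittVertex, hv, h]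
    | vertex_mul_of_ne x y h =>
      by_cases h1 : t.1 = x
      · simp [leavittVertex, hv, h1, h]
      · simp [leavittVertex, hv, h1]
    | src_mul_edge e =>
      by_cases h1 : t.1 = E.src e
      · simp [leavittVertex, leavittEdge, hv, h1]
      · simp [leavittVertex, leavittEdge, hv, h1, he0]
    | edge_mul_tgt e =>
      by_cases h1 : t.1 = E.src e ∧ ∃ m, φ e m = t.2
      · obtain ⟨x, k⟩ := t
        obtain ⟨rfl, m, rfl⟩ := h1
        simp [leavittVertex, leavittEdge, hv, he]
      · simp [leavittVertex, leavittEdge, he0 _ _ _ h1]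
    | tgt_mul_ghost e =>
      by_cases h : t.1 = E.tgt e <;> simp [leavittVertex, leavittGhost, hv, hg, h]
    | ghost_mul_src e => simp [leavittVertex, leavittGhost, hv, hg]
    | ghost_mul_edge_self e =>
      obtain ⟨x, k⟩ := t
      simp only [leavittVertex, leavittGhost, leavittEdge, map_mul, FreeAlgebra.lift_ι_apply,
        hmul, hv, hg, he]
      split_ifs with h
      · rw [← h]
      · rfl
    | ghost_mul_edge_of_ne e f h =>
      simp only [leavittGhost, leavittEdge, map_mul, FreeAlgebra.lift_ι_apply, hmul, hg, map_zero,
        LinearMap.zero_apply, Pi.zero_apply]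
      rw [he0, ite_self]
      rintro ⟨h1, m, hm⟩
      exact h ((hφ f e _ _ h1.symm).1 hm).1.symm
    | vertex_eq_sum x h =>
      obtain ⟨y, k⟩ := t
      simp only [leavittVertex, leavittGhost, leavittEdge, map_mul, map_sum,
        FreeAlgebra.lift_ι_apply, hv, LinearMap.sum_apply, Finset.sum_apply, hmul]
      split_ifs with hy
      · subst hy
        obtain ⟨e, m, rfl, rfl⟩ := hφ' y k h
        rw [Finset.sum_eq_single e]
        · simp [he, hg]
        · intro f hf hfe
          refine he0 _ _ _ ?_
          rintro ⟨h1, n, hn⟩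
          exact hfe ((hφ f e _ _ h1.symm).1 hn).1
        · simp
      · refine (Finset.sum_eq_zero fun e hex => he0 _ _ _ fun h => hy ?_).symm
        exact h.1.trans (Finset.mem_filter.1 hex).2
    | sum_vertex => simp [leavittVertex, hv, LinearMap.sum_apply, Finset.sum_apply]
  let ρ : LeavittPathAlgebra K E →ₐ[K] Module.End K (E.Vertex × ℕ → K) :=
    RingQuot.liftAlgHom K ⟨FreeAlgebra.lift K (codedAction K φ), hrel⟩
  have hρ : ρ (vertex K x) = codedAction K φ (.vertex x) :=
    (RingQuot.liftAlgHom_mkAlgHom_apply K _ hrel _).trans (FreeAlgebra.lift_ι_apply _ _)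
  intro h0
  rw [h0, map_zero] at hρ
  have h1 := hv x (fun _ => 1) (x, 0)
  rw [← hρ] at h1
  simp at h1

/-! ### Quadratic growth with exits -/

theorem ghosts_mul_vertex_mul_edges {x y : E.Vertex} {l : List E.Edge} (h : E.IsWalk x l y) :
    (l.reverse.map (ghost K)).prod * vertex K x * (l.map (edge K)).prod = vertex K y := by
  induction l generalizing x with
  | nil =>
    obtain rfl : x = y := h
    simp
  | cons e l ih =>
    obtain ⟨rfl, h⟩ := h
    rw [← ih h, ← ghost_mul_edge_self]
    simp [mul_assoc, ← mul_assoc (vertex K (E.src e)), src_mul_edge]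

theorem edges_mem_generatorSpan_pow (l : List E.Edge) :
    (l.map (edge K)).prod ∈ generatorSpan K E ^ l.length := by
  induction l with
  | nil => exact Submodule.one_le.1 le_rfl
  | cons e l ih =>
    rw [List.map_cons, List.prod_cons, List.length_cons, pow_succ']
    exact Submodule.mul_mem_mul (gen_mem_generatorSpan _) ih

theorem ghosts_mem_generatorSpan_pow (l : List E.Edge) :
    (l.map (ghost K)).prod ∈ generatorSpan K E ^ l.length := by
  induction l with
  | nil => exact Submodule.one_le.1 le_rfl
  | cons e l ih =>
    rw [List.map_cons, List.prod_cons, List.length_cons, pow_succ']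
    exact Submodule.mul_mem_mul (gen_mem_generatorSpan _) ih

/-- Inner pairs `a * b` cancel until one power is used up. A surplus `b` then dies against `c`, and
a surplus `a` against `d`. -/
theorem ghost_mul_pow_mul_pow_mul_edge {A : Type*} [Ring A] {a b c d s t : A}
    (hab : a * b = s) (hsb : s * b = b) (hsd : s * d = d) (hcb : c * b = 0) (had : a * d = 0)
    (hcd : c * d = t) (i j : ℕ) :
    c * a ^ i * (b ^ j * d) = if i = j then t else 0 := by
  have hs (j : ℕ) : s * (b ^ j * d) = b ^ j * d := by
    cases j with
    | zero => simpa using hsd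
    | succ j => rw [pow_succ', mul_assoc, ← mul_assoc s, hsb]
  induction i generalizing j with
  | zero =>
    cases j with
    | zero => simpa using hcd
    | succ j => simp [pow_succ', ← mul_assoc, hcb]
  | succ i ih =>
    cases j with
    | zero => simp [pow_succ, mul_assoc, had]
    | succ j =>
      have h : c * a ^ (i + 1) * (b ^ (j + 1) * d) = c * a ^ i * (b ^ j * d) := by
        rw [pow_succ, pow_succ']
        calc _ = c * a ^ i * ((a * b) * (b ^ j * d)) := by simp only [mul_assoc]
          _ = _ := by rw [hab, hs]
      simp [h, ih]

/-- Multiplying a relation by `z' k` on the left and `z l` on the right isolates the coefficient at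
`(k, l)`, times `t * t`. -/
theorem linearIndependent_mul_of_dual {A ι : Type*} [Ring A] [Algebra K A] [Fintype ι]
    [DecidableEq ι] {z z' : ι → A} {t : A} (ht : t * t ≠ 0)
    (h : ∀ i j, z' i * z j = if i = j then t else 0) :
    LinearIndependent K fun ij : ι × ι => z ij.1 * z' ij.2 := by
  rw [Fintype.linearIndependent_iff]
  rintro c hc ⟨k, l⟩
  have h0 := congrArg (fun a => z' k * a * z l) hc
  simp only [Finset.mul_sum, Finset.sum_mul, mul_zero, zero_mul] at h0
  rw [Finset.sum_eq_single (k, l)] at h0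
  · have h1 : z' k * (c (k, l) • (z k * z' l)) * z l = c (k, l) • (t * t) := by
      rw [mul_smul_comm, smul_mul_assoc]
      congr 1
      calc _ = (z' k * z k) * (z' l * z l) := by simp only [mul_assoc]
        _ = t * t := by simp [h]
    exact (smul_eq_zero.1 (h1.symm.trans h0)).resolve_right ht
  · rintro ⟨i, j⟩ - hij
    have h1 : z' k * (c (i, j) • (z i * z' j)) * z l =
        c (i, j) • ((z' k * z i) * (z' j * z l)) := by
      simp only [mul_smul_comm, smul_mul_assoc, mul_assoc]
    rw [h1, h, h]
    by_cases hk : k = i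
    · by_cases hl : j = l
      · exact absurd (by rw [hk, hl]) hij
      · simp [hl]
    · simp [hk]
  · simp

theorem exists_sq_le_finrank (hE : ¬ E.NoExit) :
    ∃ m, 0 < m ∧ ∀ n,
      n ^ 2 ≤ Module.finrank K (productsUpTo (generatorSpan K E) (m * n)) := by
  obtain ⟨e, f, ⟨l, hl⟩, hs, hne⟩ := DirectedMultigraph.not_noExit_iff.1 hE
  set b := ((e :: l).map (edge K)).prod with hb
  set a := ((e :: l).reverse.map (ghost K)).prod with ha
  have hsb : vertex K (E.src e) * b = b := by
    rw [hb, List.map_cons, List.prod_cons, ← mul_assoc, src_mul_edge]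
  have hab : a * b = vertex K (E.src e) := by
    rw [← hsb, ← mul_assoc]
    exact ghosts_mul_vertex_mul_edges ⟨rfl, hl⟩
  have hcb : ghost K f * b = 0 := by
    rw [hb, List.map_cons, List.prod_cons, ← mul_assoc, ghost_mul_edge_of_ne hne, zero_mul]
  have had : a * edge K f = 0 := by
    simp [ha, mul_assoc, ghost_mul_edge_of_ne (Ne.symm hne)]
  have hsd : vertex K (E.src e) * edge K f = edge K f := by rw [← hs, src_mul_edge]
  have hdual := ghost_mul_pow_mul_pow_mul_edge hab hsb hsd hcb had (ghost_mul_edge_self f)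
  have hbm : b ∈ generatorSpan K E ^ (l.length + 1) := edges_mem_generatorSpan_pow (e :: l)
  have ham : a ∈ generatorSpan K E ^ (l.length + 1) := by
    simpa only [List.length_reverse, List.length_cons] using
      ghosts_mem_generatorSpan_pow (K := K) (e :: l).reverse
  -- With `L = l.length + 1` and `i, j ≤ n - 1`, the words below have length `L * (i + j) + 2 ≤ 2 *
  -- L * n`.
  refine ⟨2 * (l.length + 1), by omega, fun n => ?_⟩
  have hli : LinearIndependent K fun ij : Fin n × Fin n =>
      (b ^ (ij.1 : ℕ) * edge K f) * (ghost K f * a ^ (ij.2 : ℕ)) := by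
    refine linearIndependent_mul_of_dual (z := fun i : Fin n => b ^ (i : ℕ) * edge K f)
      (z' := fun i : Fin n => ghost K f * a ^ (i : ℕ)) (t := vertex K (E.tgt f)) ?_ fun i j => ?_
    · rw [vertex_mul_self]
      exact vertex_ne_zero _
    · simp only [hdual, Fin.ext_iff]
  have := (isGeneratingSubspace_generatorSpan (K := K) (E := E)).1
  have hcard := finrank_span_eq_card hli
  rw [Fintype.card_prod, Fintype.card_fin, ← sq] at hcard
  rw [← hcard]
  refine Submodule.finrank_mono (Submodule.span_le.2 ?_)
  rintro _ ⟨⟨i, j⟩, rfl⟩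
  have hi := i.isLt
  have hj := j.isLt
  have hmem : (b ^ (i : ℕ) * edge K f) * (ghost K f * a ^ (j : ℕ)) ∈
      generatorSpan K E ^ (((l.length + 1) * i + 1) + (1 + (l.length + 1) * j)) := by
    rw [pow_add, pow_add, pow_add, pow_one, pow_mul, pow_mul]
    exact Submodule.mul_mem_mul
      (Submodule.mul_mem_mul (Submodule.pow_mem_pow _ hbm _) (gen_mem_generatorSpan _))
      (Submodule.mul_mem_mul (gen_mem_generatorSpan _) (Submodule.pow_mem_pow _ ham _))
  exact pow_le_productsUpTo _ (by omega) (by nlinarith) hmem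

theorem two_le_growthExponent_generatorSpan (hE : ¬ E.NoExit) :
    2 ≤ growthExponent (generatorSpan K E) := by
  obtain ⟨m, hm, h⟩ := exists_sq_le_finrank (K := K) hE
  have h2 := growthRate_le_of_le_comp_mul (f := fun n => n ^ 2)
    (g := fun n => Module.finrank K (productsUpTo (generatorSpan K E) n)) hm h
  rw [growthRate_pow] at h2
  exact_mod_cast h2

end LeavittPathAlgebra

theorem mainTheorem8 (K : Type w) [Field K] (E : DirectedMultigraph.{u, v})
    [Fintype E.Vertex] [Fintype E.Edge] :
    ∃ d : EReal, HasGKDim K (LeavittPathAlgebra K E) d ∧ (E.NoExit ↔ d ≤ 1) := by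
  refine ⟨_, LeavittPathAlgebra.isGeneratingSubspace_generatorSpan.hasGKDim,
    LeavittPathAlgebra.growthExponent_generatorSpan_le_one, fun h => ?_⟩
  by_contra hE
  have h2 := (LeavittPathAlgebra.two_le_growthExponent_generatorSpan (K := K) hE).trans h
  exact absurd h2 (by norm_num)
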